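/- A generalized composition of an integer $n\ge 1$ is a word $v_1^{w_1}v_2^{w_2}\cdots v_k^{w_k}$ (i.e. a finite sequence of pairs $(v_i,w_i)$, of any length $k\ge 1$) with $v_i,w_i\in\mathbb{Z}_{>0}$ and $\sum_{i=1}^k v_iw_i=n$; its greatest common divisor is $\gcd(v_1,\dots,v_k)$ (which is $v_1$ if $k=1$). Let $c_n$ be the number of generalized compositions of $n$, and let $d_n$ be the number of those with greatest common divisor $1$. Let $\sigma(z)=\sum_{n\ge 1}\frac{z^n}{1-z^n}$. Then the equation $\sigma(z)=1$ has a unique real root $\rho$ in $[0,1]$, this root satisfies $|\rho-0.406|<0.0005$, the function $\sigma$ is differentiable at $\rho$, and, as $n\to\infty$, $$d_n\sim\frac{1}{\rho\,\sigma'(\rho)}\,\rho^{-n},\qquad c_n\sim\frac{1}{\rho\,\sigma'(\rho)}\,\rho^{-n},\qquad \frac{d_n}{c_n}\to 1,$$ where $a_n\sim b_n$ means $\lim_{n\to\infty}a_n/b_n=1$. -/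

import Mathlib

/-- The number `∑ i, v i * w i` of which the word `v₁^{w₁} ⋯ v_k^{w_k}`, given as the list of the
pairs `(v i, w i)`, is a generalized composition. -/
def wordSum (l : List (ℕ × ℕ)) : ℕ :=
  (l.map fun p => p.1 * p.2).sum

/-- The greatest common divisor `gcd (v₁, …, v_k)` of a word; it is `v₁` when `k = 1`. -/
def wordGcd (l : List (ℕ × ℕ)) : ℕ :=
  (l.map Prod.fst).foldr Nat.gcd 0

/-- The generalized compositions of `n`: words `v₁^{w₁} ⋯ v_k^{w_k}` of arbitrary length `k` with
all `v i, w i > 0` and `∑ i, v i * w i = n`. -/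
def genCompositions (n : ℕ) : Set (List (ℕ × ℕ)) :=
  {l | (∀ p ∈ l, 0 < p.1 ∧ 0 < p.2) ∧ wordSum l = n}

/-- The generalized compositions of `n` with greatest common divisor `1`. -/
def primGenCompositions (n : ℕ) : Set (List (ℕ × ℕ)) :=
  {l | l ∈ genCompositions n ∧ wordGcd l = 1}

/-- There are finitely many generalized compositions of `n`, so that `Set.ncard` below is their
true number. -/
theorem genCompositions_finite (n : ℕ) : (genCompositions n).Finite := by
  have key : ∀ l : List (ℕ × ℕ), (∀ p ∈ l, 0 < p.1 ∧ 0 < p.2) →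
      l.length ≤ wordSum l ∧ ∀ p ∈ l, p.1 ≤ wordSum l ∧ p.2 ≤ wordSum l := by
    intro l
    induction l with
    | nil => intro _; simp [wordSum]
    | cons q t ih =>
      intro h
      obtain ⟨h1, h2⟩ := ih fun p hp => h p (List.mem_cons_of_mem _ hp)
      obtain ⟨ha, hb⟩ := h q List.mem_cons_self
      have hs : wordSum (q :: t) = q.1 * q.2 + wordSum t := by simp [wordSum]
      have e1 : q.1 ≤ q.1 * q.2 := Nat.le_mul_of_pos_right _ hb
      have e2 : q.2 ≤ q.1 * q.2 := Nat.le_mul_of_pos_left _ ha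
      refine ⟨by rw [hs, List.length_cons]; omega, fun p hp => ?_⟩
      rcases List.mem_cons.1 hp with rfl | hp
      · omega
      · have := h2 p hp
        omega
  refine ((List.finite_length_le (Fin (n + 1) × Fin (n + 1)) n).image
    (List.map fun p => ((p.1 : ℕ), (p.2 : ℕ)))).subset ?_
  rintro l ⟨hl, hn⟩
  obtain ⟨h1, h2⟩ := key l hl
  rw [hn] at h1 h2
  refine ⟨l.map fun p => (Fin.ofNat (n + 1) p.1, Fin.ofNat (n + 1) p.2), by simpa using h1, ?_⟩
  rw [List.map_map]
  conv_rhs => rw [← List.map_id l]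
  refine List.map_congr_left fun p hp => ?_
  obtain ⟨ha, hb⟩ := h2 p hp
  simp [Fin.ofNat, Nat.mod_eq_of_lt (Nat.lt_succ_of_le ha), Nat.mod_eq_of_lt (Nat.lt_succ_of_le hb)]

/-- `c_n`, the number of generalized compositions of `n`. -/
noncomputable def cSeq (n : ℕ) : ℕ := (genCompositions n).ncard

/-- `d_n`, the number of generalized compositions of `n` with greatest common divisor `1`. -/
noncomputable def dSeq (n : ℕ) : ℕ := (primGenCompositions n).ncard

/-- `σ(z) = ∑_{n ≥ 1} z^n / (1 - z^n)`. The sum is `0` where the series diverges, and `σ(1) = 0`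
by the convention `1 / 0 = 0`; hence `σ(z) = 1` on `[0, 1]` means that `z < 1` and that the series
converges to `1`. -/
noncomputable def lambertSigma (z : ℝ) : ℝ := ∑' n : ℕ, z ^ (n + 1) / (1 - z ^ (n + 1))

/-!
Splitting off the first letter of a word, for which there are `τ(k)` choices with `v * w = k` (`τ`
the number of divisors), shows that `c` solves the renewal equation with weights `τ(k)`, the
coefficients of `σ`. At the root `ρ` of `σ = 1` the weights `τ(k) ρ ^ k` form a probability
distribution of mean `ρ σ'(ρ)`, so the renewal theorem gives
`c_n ρ ^ n → 1 / (ρ σ'(ρ))`.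

The renewal theorem itself follows from a maximum principle: along an ultrafilter realizing the
largest (or smallest) cluster point of `u`, the limits of the shifts `u (n - k)` form a harmonic
function of `k` with an extremum at `0`, which is constant by aperiodicity; an invariant of the
renewal equation then forces the constant to be the reciprocal of the mean.

Dividing a word by its greatest common divisor gives `c_n = ∑_{m ∣ n} d_m`. Proper divisors are at
most `n / 2`, so that `c_n - d_n` is exponentially smaller than `c_n`.
-/

open Filter Topology Finset

/-! ### The renewal theorem -/

section Tails

theorem sum_range_sub_sum_range_succ {R : Type*} [CommRing R] (p : ℕ → R) (P : R) (N : ℕ) :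
    ∑ k ∈ range N, (P - ∑ j ∈ range (k + 1), p j) =
      ∑ k ∈ range N, k * p k + N * (P - ∑ j ∈ range N, p j) := by
  induction N with
  | zero => simp
  | succ N ih =>
    rw [sum_range_succ, ih, sum_range_succ (fun k => (k : R) * p k), sum_range_succ p N]
    push_cast
    ring

variable {p : ℕ → ℝ} {P : ℝ}

theorem tendsto_mul_sub_sum_range_zero (hp : ∀ k, 0 ≤ p k) (hP : HasSum p P)
    (hm : Summable fun k : ℕ => (k : ℝ) * p k) :
    Tendsto (fun N : ℕ => N * (P - ∑ j ∈ range N, p j)) atTop (𝓝 0) := by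
  refine squeeze_zero (fun N => mul_nonneg N.cast_nonneg
    (sub_nonneg.2 (sum_le_hasSum _ (fun j _ => hp j) hP))) (fun N => ?_)
    (tendsto_sum_nat_add fun k : ℕ => (k : ℝ) * p k)
  have htail : HasSum (fun k => N * p (k + N)) (N * (P - ∑ j ∈ range N, p j)) :=
    ((hasSum_nat_add_iff' N).2 hP).mul_left _
  refine hasSum_le (fun k => ?_) htail ((summable_nat_add_iff N).2 hm).hasSum
  gcongr
  · exact hp _
  · exact Nat.le_add_left N k

theorem hasSum_sub_sum_range_succ (hp : ∀ k, 0 ≤ p k) (hP : HasSum p P)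
    (hm : Summable fun k : ℕ => (k : ℝ) * p k) :
    HasSum (fun k => P - ∑ j ∈ range (k + 1), p j) (∑' k : ℕ, (k : ℝ) * p k) := by
  rw [hasSum_iff_tendsto_nat_of_nonneg
    fun k => sub_nonneg.2 (sum_le_hasSum _ (fun j _ => hp j) hP)]
  simpa only [sum_range_sub_sum_range_succ, add_zero] using
    hm.hasSum.tendsto_sum_nat.add (tendsto_mul_sub_sum_range_zero hp hP hm)

end Tails

theorem tendsto_sum_antidiagonal_mul {ι R : Type*} [NormedRing R] [CompleteSpace R]
    {a u b : ℕ → R} {C : ℝ} {F : Filter ι} {N : ι → ℕ} (ha : Summable fun k => ‖a k‖)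
    (hu : ∀ n, ‖u n‖ ≤ C) (hN : Tendsto N F atTop)
    (hb : ∀ k, Tendsto (fun i => u (N i - k)) F (𝓝 (b k))) :
    Tendsto (fun i => ∑ q ∈ antidiagonal (N i), a q.1 * u q.2) F (𝓝 (∑' k, a k * b k)) := by
  have hC : 0 ≤ C := (norm_nonneg _).trans (hu 0)
  have hlim : Tendsto (fun i => ∑' k, if k ≤ N i then a k * u (N i - k) else 0) F
      (𝓝 (∑' k, a k * b k)) := by
    refine tendsto_tsum_of_dominated_convergence (ha.mul_right C) (fun k => ?_)
      (.of_forall fun i k => ?_)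
    · refine ((hb k).const_mul (a k)).congr' ?_
      filter_upwards [hN.eventually_ge_atTop k] with i hi
      rw [if_pos hi]
    · split_ifs
      · exact (norm_mul_le _ _).trans (by gcongr; exact hu _)
      · rw [norm_zero]
        positivity
  refine hlim.congr fun i => ?_
  rw [tsum_eq_sum (s := range (N i + 1)),
    Nat.sum_antidiagonal_eq_sum_range_succ fun j k => a j * u k]
  · exact sum_congr rfl fun k hk => if_pos (mem_range_succ_iff.1 hk)
  · exact fun k hk => if_neg (mt mem_range_succ_iff.2 hk)

/-- The law of the step of a renewal process: a probability distribution on the positive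
integers, encoded by its mass function extended by `p 0 = 0`. -/
structure IsStepDistribution (p : ℕ → ℝ) : Prop where
  nonneg (k : ℕ) : 0 ≤ p k
  apply_zero : p 0 = 0
  hasSum_one : HasSum p 1

/-- The solution `u` of the renewal equation with step weights `p`: if `p` is a step distribution,
`u n` is the probability that `n` is a renewal time. When `p 0 = 0`, the equation says that the
generating functions satisfy `U = 1 / (1 - P)`. -/
structure IsRenewalSequence {R : Type*} [Semiring R] (p u : ℕ → R) : Prop where
  apply_zero : u 0 = 1
  apply_of_pos {n : ℕ} (hn : 0 < n) : u n = ∑ q ∈ antidiagonal n, p q.1 * u q.2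

/-- The functions that are harmonic for the walk on `ℕ` which jumps from `j` to `j + k` with
probability `p k`; convergence of the averages is part of the notion. -/
def IsStepHarmonic (p b : ℕ → ℝ) : Prop :=
  ∀ j, HasSum (fun k => p k * b (j + k)) (b j)

namespace IsStepHarmonic

variable {p b : ℕ → ℝ}

theorem neg (hb : IsStepHarmonic p b) : IsStepHarmonic p (-b) := fun j => by
  simpa only [Pi.neg_apply, mul_neg] using (hb j).neg

theorem apply_add_eq_of_isMaxOn {j k : ℕ} (hb : IsStepHarmonic p b) (hp : IsStepDistribution p)
    (hmax : IsMaxOn b Set.univ j) (hk : p k ≠ 0) : b (j + k) = b j := by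
  have hdefect : HasSum (fun k => p k * (b j - b (j + k))) 0 := by
    simpa only [one_mul, sub_self, mul_sub] using (hp.hasSum_one.mul_right (b j)).sub (hb j)
  have hzero := (hasSum_zero_iff_of_nonneg fun k =>
    mul_nonneg (hp.nonneg k) (sub_nonneg.2 (hmax (Set.mem_univ _)))).1 hdefect
  have := (mul_eq_zero.1 (congrFun hzero k)).resolve_left hk
  linarith

theorem eq_const_of_eventually {c : ℝ} (hb : IsStepHarmonic p b)
    (hp : IsStepDistribution p) (hc : ∀ᶠ j in atTop, b j = c) (j : ℕ) : b j = c := by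
  obtain ⟨N, hN⟩ := eventually_atTop.1 hc
  suffices ∀ i j, N ≤ i + j → b j = c from this N j (Nat.le_add_right N j)
  intro i
  induction i with
  | zero => simpa only [zero_add] using hN
  | succ i ih =>
    intro j hij
    have hstep (k : ℕ) : p k * b (j + k) = p k * c := by
      rcases Nat.eq_zero_or_pos k with rfl | hk
      · simp only [hp.apply_zero, zero_mul]
      · rw [ih (j + k) (by lia)]
    have hsum := hb j
    simp only [hstep] at hsum
    simpa only [one_mul] using hsum.unique (hp.hasSum_one.mul_right c)

-- The maximum propagates from `0` to the additive monoid generated by the support of `p`, which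
-- contains all large integers, and then back down by harmonicity.
theorem eq_apply_zero_of_isMaxOn (hb : IsStepHarmonic p b) (hp : IsStepDistribution p)
    (haper : Nat.setGcd p.support = 1) (hmax : IsMaxOn b Set.univ 0) (k : ℕ) : b k = b 0 := by
  let S : AddSubmonoid ℕ :=
    { carrier := {k | ∀ j, b j = b 0 → b (j + k) = b 0}
      zero_mem' := fun _ hj => hj
      add_mem' := fun {k l} hk hl j hj => by
        rw [← add_assoc]
        exact hl _ (hk j hj) }
  have hS : AddSubmonoid.closure p.support ≤ S := AddSubmonoid.closure_le.2 fun k hk j hj =>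
    (hb.apply_add_eq_of_isMaxOn hp (fun i hi => hj ▸ hmax hi) hk).trans hj
  obtain ⟨N, hN⟩ := Nat.exists_mem_closure_of_ge p.support
  refine hb.eq_const_of_eventually hp (eventually_atTop.2 ⟨N, fun k hk => ?_⟩) k
  simpa only [zero_add] using hS (hN k hk (haper ▸ one_dvd k)) 0 rfl

theorem eq_apply_zero_of_isMinOn (hb : IsStepHarmonic p b) (hp : IsStepDistribution p)
    (haper : Nat.setGcd p.support = 1) (hmin : IsMinOn b Set.univ 0) (k : ℕ) : b k = b 0 :=
  neg_injective (hb.neg.eq_apply_zero_of_isMaxOn hp haper hmin.neg k)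

end IsStepHarmonic

namespace IsRenewalSequence

theorem mul_pow {R : Type*} [CommSemiring R] {p u : ℕ → R} (hu : IsRenewalSequence p u) (x : R) :
    IsRenewalSequence (fun n => p n * x ^ n) (fun n => u n * x ^ n) where
  apply_zero := by simp [hu.apply_zero]
  apply_of_pos {n} hn := by
    rw [hu.apply_of_pos hn, sum_mul]
    refine sum_congr rfl fun q hq => ?_
    rw [← mem_antidiagonal.1 hq, pow_add]
    ring

theorem sum_antidiagonal_tail_mul {R : Type*} [Ring R] {p u : ℕ → R} (hu : IsRenewalSequence p u)
    (hp : p 0 = 0) (n : ℕ) :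
    ∑ q ∈ antidiagonal n, (1 - ∑ j ∈ range (q.1 + 1), p j) * u q.2 = 1 := by
  induction n with
  | zero => simp [hp, hu.apply_zero]
  | succ n ih =>
    have hrec := hu.apply_of_pos n.succ_pos
    rw [Nat.sum_antidiagonal_succ] at hrec ⊢
    simp only [hp, zero_mul, zero_add, range_one, sum_singleton, sub_zero, one_mul] at hrec ⊢
    rw [hrec, ← sum_add_distrib]
    refine (sum_congr rfl fun q _ => ?_).trans ih
    rw [sum_range_succ _ (q.1 + 1), ← add_mul, sub_add_eq_sub_sub, add_sub_cancel]

variable {p u : ℕ → ℝ}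

theorem nonneg (hu : IsRenewalSequence p u) (hp : ∀ k, 0 ≤ p k) (hp0 : p 0 = 0) (n : ℕ) :
    0 ≤ u n := by
  induction n using Nat.strong_induction_on with
  | _ n ih =>
    rcases Nat.eq_zero_or_pos n with rfl | hn
    · exact hu.apply_zero ▸ zero_le_one
    rw [hu.apply_of_pos hn]
    refine sum_nonneg fun q hq => ?_
    rcases Nat.eq_zero_or_pos q.1 with h | h
    · rw [h, hp0, zero_mul]
    · exact mul_nonneg (hp _) (ih _ (by have := mem_antidiagonal.1 hq; lia))

theorem le_one (hu : IsRenewalSequence p u) (hp : IsStepDistribution p) (n : ℕ) : u n ≤ 1 := by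
  have htail (k : ℕ) : 0 ≤ 1 - ∑ j ∈ range (k + 1), p j :=
    sub_nonneg.2 (sum_le_hasSum _ (fun j _ => hp.nonneg j) hp.hasSum_one)
  rw [← hu.sum_antidiagonal_tail_mul hp.apply_zero n]
  simpa [hp.apply_zero] using
    single_le_sum (f := fun q : ℕ × ℕ => (1 - ∑ j ∈ range (q.1 + 1), p j) * u q.2)
      (fun q _ => mul_nonneg (htail _) (hu.nonneg hp.nonneg hp.apply_zero _))
      (show (0, n) ∈ antidiagonal n from mem_antidiagonal.2 (zero_add n))

theorem mem_Icc (hu : IsRenewalSequence p u) (hp : IsStepDistribution p) (n : ℕ) :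
    u n ∈ Set.Icc (0 : ℝ) 1 :=
  ⟨hu.nonneg hp.nonneg hp.apply_zero n, hu.le_one hp n⟩

-- `b k` is the limit of `u (n - k)` along an ultrafilter on which `u` tends to `l`.
theorem exists_isStepHarmonic_of_mapClusterPt {l : ℝ} (hu : IsRenewalSequence p u)
    (hp : IsStepDistribution p) (hm : Summable fun k : ℕ => (k : ℝ) * p k)
    (hl : MapClusterPt l atTop u) :
    ∃ b : ℕ → ℝ, b 0 = l ∧ (∀ k, MapClusterPt (b k) atTop u) ∧ IsStepHarmonic p b ∧
      ∑' k, (1 - ∑ j ∈ range (k + 1), p j) * b k = 1 := by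
  obtain ⟨F, hF, hFl⟩ := mapClusterPt_iff_ultrafilter.1 hl
  have hshift (k : ℕ) : Tendsto (fun n => n - k) F atTop := (tendsto_sub_atTop_nat k).mono_left hF
  have hlim (k : ℕ) : ∃ x ∈ Set.Icc (0 : ℝ) 1, Tendsto (fun n => u (n - k)) F (𝓝 x) :=
    isCompact_Icc.ultrafilter_le_nhds' (F.map fun n => u (n - k))
      (univ_mem' (f := (F : Filter ℕ)) fun n => hu.mem_Icc hp (n - k))
  choose b hb01 hb using hlim
  have norm_le_one {x : ℝ} (hx : x ∈ Set.Icc (0 : ℝ) 1) : ‖x‖ ≤ 1 := by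
    rw [Real.norm_of_nonneg hx.1]
    exact hx.2
  have hu1 (n : ℕ) : ‖u n‖ ≤ 1 := norm_le_one (hu.mem_Icc hp n)
  refine ⟨b, tendsto_nhds_unique (hb 0) hFl,
    fun k => (hb k).mapClusterPt.of_comp (hshift k), fun j => ?_, ?_⟩
  · have hsum : Summable fun k => p k * b (j + k) := hp.hasSum_one.summable.norm.of_norm_bounded
      fun k => (norm_mul_le _ _).trans
        (mul_le_of_le_one_right (norm_nonneg _) (norm_le_one (hb01 _)))
    have hconv := tendsto_sum_antidiagonal_mul (b := fun k => b (j + k))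
      hp.hasSum_one.summable.norm hu1 (hshift j)
      fun k => by simpa only [Nat.sub_sub] using hb (j + k)
    have hrec : ∀ᶠ n in (F : Filter ℕ), ∑ q ∈ antidiagonal (n - j), p q.1 * u q.2 = u (n - j) := by
      filter_upwards [(hshift j).eventually_gt_atTop 0] with n hn using (hu.apply_of_pos hn).symm
    exact tendsto_nhds_unique (hb j) (hconv.congr' hrec) ▸ hsum.hasSum
  · have htail := (hasSum_sub_sum_range_succ hp.nonneg hp.hasSum_one hm).summable.norm
    have hconv := tendsto_sum_antidiagonal_mul htail hu1 (tendsto_id.mono_left hF) hb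
    simp only [id_eq, hu.sum_antidiagonal_tail_mul hp.apply_zero] at hconv
    exact tendsto_nhds_unique hconv tendsto_const_nhds

theorem eq_one_div_mean_of_isGreatest_or_isLeast {l : ℝ} (hu : IsRenewalSequence p u)
    (hp : IsStepDistribution p) (haper : Nat.setGcd p.support = 1)
    (hm : Summable fun k : ℕ => (k : ℝ) * p k)
    (hext : IsGreatest {a | MapClusterPt a atTop u} l ∨ IsLeast {a | MapClusterPt a atTop u} l) :
    l = 1 / ∑' k : ℕ, (k : ℝ) * p k := by
  obtain ⟨b, rfl, hbc, hbh, hbsum⟩ :=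
    hu.exists_isStepHarmonic_of_mapClusterPt hp hm (hext.elim (·.1) (·.1))
  have hconst (k : ℕ) : b k = b 0 := by
    rcases hext with hmax | hmin
    · exact hbh.eq_apply_zero_of_isMaxOn hp haper (fun k _ => hmax.2 (hbc k)) k
    · exact hbh.eq_apply_zero_of_isMinOn hp haper (fun k _ => hmin.2 (hbc k)) k
  simp only [hconst, tsum_mul_right,
    (hasSum_sub_sum_range_succ hp.nonneg hp.hasSum_one hm).tsum_eq] at hbsum
  exact eq_one_div_of_mul_eq_one_right hbsum

/-- The **Erdős–Feller–Pollard renewal theorem**, for step distributions of finite mean. -/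
theorem tendsto_one_div_mean (hu : IsRenewalSequence p u) (hp : IsStepDistribution p)
    (haper : Nat.setGcd p.support = 1) (hm : Summable fun k : ℕ => (k : ℝ) * p k) :
    Tendsto u atTop (𝓝 (1 / ∑' k : ℕ, (k : ℝ) * p k)) := by
  have hmem := hu.mem_Icc hp
  let K : Set ℝ := {a | MapClusterPt a atTop u}
  have hK : IsCompact K := isCompact_Icc.of_isClosed_subset isClosed_setOfPred_clusterPt
    fun a ha => isClosed_Icc.mem_of_mapClusterPt ha (.of_forall hmem)
  have hKne : K.Nonempty := by
    obtain ⟨a, -, ha⟩ := isCompact_Icc.exists_mapClusterPt (u := u) (f := atTop)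
      (tendsto_principal.2 (.of_forall hmem))
    exact ⟨a, ha⟩
  obtain ⟨M, hmax⟩ := hK.exists_isGreatest hKne
  obtain ⟨m, hmin⟩ := hK.exists_isLeast hKne
  have hmax_eq := hu.eq_one_div_mean_of_isGreatest_or_isLeast hp haper hm (.inl hmax)
  have hmin_eq := hu.eq_one_div_mean_of_isGreatest_or_isLeast hp haper hm (.inr hmin)
  exact isCompact_Icc.tendsto_nhds_of_unique_mapClusterPt (.of_forall hmem) fun a _ ha =>
    le_antisymm (hmax_eq ▸ hmax.2 ha) (hmin_eq ▸ hmin.2 ha)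

end IsRenewalSequence

/-! ### Generalized compositions -/

theorem wordSum_cons (p : ℕ × ℕ) (l : List (ℕ × ℕ)) :
    wordSum (p :: l) = p.1 * p.2 + wordSum l := by
  simp [wordSum]

theorem wordGcd_cons (p : ℕ × ℕ) (l : List (ℕ × ℕ)) :
    wordGcd (p :: l) = Nat.gcd p.1 (wordGcd l) := rfl

theorem cons_mem_genCompositions_iff {p : ℕ × ℕ} {l : List (ℕ × ℕ)} {n : ℕ} :
    p :: l ∈ genCompositions n ↔
      ∃ q ∈ antidiagonal n, p ∈ q.1.divisorsAntidiagonal ∧ l ∈ genCompositions q.2 := by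
  simp only [genCompositions, Set.mem_ofPred_eq, List.forall_mem_cons, wordSum_cons,
    HasAntidiagonal.mem_antidiagonal, Nat.mem_divisorsAntidiagonal, Prod.exists]
  constructor
  · rintro ⟨⟨⟨hv, hw⟩, hl⟩, hn⟩
    exact ⟨_, _, hn, ⟨rfl, (Nat.mul_pos hv hw).ne'⟩, hl, rfl⟩
  · rintro ⟨_, _, hn, ⟨rfl, hne⟩, hl, rfl⟩
    exact ⟨⟨⟨Nat.pos_of_ne_zero (left_ne_zero_of_mul hne),
      Nat.pos_of_ne_zero (right_ne_zero_of_mul hne)⟩, hl⟩, hn⟩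

theorem nil_mem_genCompositions_iff {n : ℕ} : [] ∈ genCompositions n ↔ n = 0 := by
  simp [genCompositions, wordSum, eq_comm]

theorem genCompositions_zero : genCompositions 0 = {[]} := by
  ext l
  cases l with
  | nil => simp [nil_mem_genCompositions_iff]
  | cons p l => simp [cons_mem_genCompositions_iff]

theorem cSeq_eq_sum_antidiagonal {n : ℕ} (hn : 0 < n) :
    cSeq n = ∑ q ∈ antidiagonal n, #q.1.divisors * cSeq q.2 := by
  let G (m : ℕ) : Finset (List (ℕ × ℕ)) := (genCompositions_finite m).toFinset
  have hG (m : ℕ) : cSeq m = #(G m) := Set.ncard_eq_toFinset_card _ _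
  have mem_G {m : ℕ} {l : List (ℕ × ℕ)} : l ∈ G m ↔ l ∈ genCompositions m :=
    Set.Finite.mem_toFinset _
  have hcons : #((antidiagonal n).sigma fun q => q.1.divisorsAntidiagonal ×ˢ G q.2) = #(G n) := by
    refine card_bij (fun x _ => x.2.1 :: x.2.2) ?_ ?_ ?_
    · rintro ⟨q, p, l⟩ hx
      simp only [mem_sigma, mem_product, mem_G] at hx
      exact mem_G.2 (cons_mem_genCompositions_iff.2 ⟨q, hx⟩)
    · rintro ⟨⟨a, b⟩, p, l⟩ hx ⟨⟨a', b'⟩, p', l'⟩ hx' heq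
      simp only [mem_sigma, mem_product, mem_G, Nat.mem_divisorsAntidiagonal] at hx hx'
      obtain ⟨rfl, rfl⟩ := List.cons.inj heq
      obtain ⟨-, ⟨rfl, -⟩, -, rfl⟩ := hx
      obtain ⟨-, ⟨rfl, -⟩, -, rfl⟩ := hx'
      rfl
    · rintro (_ | ⟨p, l⟩) hl
      · exact absurd (nil_mem_genCompositions_iff.1 (mem_G.1 hl)) hn.ne'
      · obtain ⟨q, hx⟩ := cons_mem_genCompositions_iff.1 (mem_G.1 hl)
        exact ⟨⟨q, p, l⟩, by simpa only [mem_sigma, mem_product, mem_G] using hx, rfl⟩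
  rw [hG, ← hcons, card_sigma]
  refine sum_congr rfl fun q _ => ?_
  rw [card_product, hG, ← Nat.map_div_right_divisors, card_map]

theorem isRenewalSequence_cSeq :
    IsRenewalSequence (fun n => (#n.divisors : ℝ)) (fun n => (cSeq n : ℝ)) where
  apply_zero := by simp [cSeq, genCompositions_zero]
  apply_of_pos hn := by exact_mod_cast cSeq_eq_sum_antidiagonal hn

/-- The word `(g v₁)^{w₁} ⋯ (g v_k)^{w_k}`. Scaling by `g > 0` identifies the primitive words with
the words of greatest common divisor `g`. -/
def scaleWord (g : ℕ) (l : List (ℕ × ℕ)) : List (ℕ × ℕ) :=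
  l.map (Prod.map (g * ·) id)

theorem scaleWord_injective {g : ℕ} (hg : 0 < g) : Function.Injective (scaleWord g) :=
  List.map_injective_iff.2
    (Prod.map_injective.2 ⟨mul_right_injective₀ hg.ne', Function.injective_id⟩)

theorem wordSum_scaleWord (g : ℕ) (l : List (ℕ × ℕ)) :
    wordSum (scaleWord g l) = g * wordSum l := by
  simp [wordSum, scaleWord, Function.comp_def, mul_assoc, List.sum_map_mul_left]

theorem wordGcd_scaleWord (g : ℕ) (l : List (ℕ × ℕ)) :
    wordGcd (scaleWord g l) = g * wordGcd l := by
  induction l with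
  | nil => rfl
  | cons p l ih =>
    rw [wordGcd_cons, ← Nat.gcd_mul_left, ← ih]
    rfl

theorem dvd_wordGcd_iff {g : ℕ} {l : List (ℕ × ℕ)} : g ∣ wordGcd l ↔ ∀ p ∈ l, g ∣ p.1 := by
  induction l with
  | nil => simp [wordGcd]
  | cons p l ih => rw [wordGcd_cons, Nat.dvd_gcd_iff, ih, List.forall_mem_cons]

theorem exists_scaleWord_wordGcd_eq (l : List (ℕ × ℕ)) :
    ∃ l', scaleWord (wordGcd l) l' = l := by
  change l ∈ Set.range (List.map _)
  rw [Set.range_list_map]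
  rintro ⟨v, w⟩ hp
  obtain ⟨c, rfl⟩ := dvd_wordGcd_iff.1 dvd_rfl _ hp
  exact ⟨(c, w), rfl⟩

theorem wordGcd_dvd_wordSum (l : List (ℕ × ℕ)) : wordGcd l ∣ wordSum l := by
  obtain ⟨l', hl'⟩ := exists_scaleWord_wordGcd_eq l
  exact ⟨wordSum l', by rw [← wordSum_scaleWord, hl']⟩

theorem scaleWord_mem_genCompositions_iff {g m : ℕ} {l : List (ℕ × ℕ)} (hg : 0 < g) :
    scaleWord g l ∈ genCompositions (g * m) ↔ l ∈ genCompositions m := by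
  simp only [genCompositions, Set.mem_ofPred_eq, wordSum_scaleWord, Nat.mul_right_inj hg.ne']
  simp only [scaleWord, List.forall_mem_map, Prod.map_fst, Prod.map_snd, id_eq,
    Nat.mul_pos_iff_of_pos_left hg]

theorem setOf_wordGcd_eq_image_scaleWord {g : ℕ} (hg : 0 < g) (m : ℕ) :
    {l ∈ genCompositions (g * m) | wordGcd l = g} = scaleWord g '' primGenCompositions m := by
  ext l
  constructor
  · rintro ⟨hl, hgcd⟩
    obtain ⟨l', hl'⟩ := exists_scaleWord_wordGcd_eq l
    rw [hgcd] at hl'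
    subst hl'
    rw [wordGcd_scaleWord, Nat.mul_eq_left hg.ne'] at hgcd
    exact ⟨l', ⟨(scaleWord_mem_genCompositions_iff hg).1 hl, hgcd⟩, rfl⟩
  · rintro ⟨l', ⟨hl', hgcd⟩, rfl⟩
    exact ⟨(scaleWord_mem_genCompositions_iff hg).2 hl', by rw [wordGcd_scaleWord, hgcd, mul_one]⟩

theorem cSeq_eq_sum_divisors_dSeq {n : ℕ} (hn : n ≠ 0) : cSeq n = ∑ m ∈ n.divisors, dSeq m := by
  let G : Finset (List (ℕ × ℕ)) := (genCompositions_finite n).toFinset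
  have hfiber : ∀ g ∈ n.divisors, #{l ∈ G | wordGcd l = g} = dSeq (n / g) := by
    intro g hg
    obtain ⟨m, rfl⟩ := Nat.dvd_of_mem_divisors hg
    have hg0 : 0 < g := Nat.pos_of_mem_divisors hg
    rw [Nat.mul_div_cancel_left m hg0, dSeq,
      ← Set.ncard_image_of_injective _ (scaleWord_injective hg0),
      ← setOf_wordGcd_eq_image_scaleWord hg0, ← Set.ncard_coe_finset]
    simp [G]
  have hmaps : (G : Set (List (ℕ × ℕ))).MapsTo wordGcd n.divisors := fun l hl => by
    have hl' : l ∈ genCompositions n := by simpa [G] using hl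
    exact Nat.mem_divisors.2 ⟨hl'.2 ▸ wordGcd_dvd_wordSum l, hn⟩
  rw [cSeq, Set.ncard_eq_toFinset_card _ (genCompositions_finite n),
    card_eq_sum_card_fiberwise hmaps, sum_congr rfl hfiber, Nat.sum_div_divisors]

theorem dSeq_le_cSeq (n : ℕ) : dSeq n ≤ cSeq n :=
  Set.ncard_le_ncard (fun _ h => h.1) (genCompositions_finite n)

/-! ### The Lambert series -/

theorem hasDerivAt_tsum_mul_pow {𝕜 : Type*} [RCLike 𝕜] {a : ℕ → 𝕜} {r : ℝ} {z : 𝕜}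
    (ha : Summable fun n : ℕ => ‖a n‖ * (n * r ^ (n - 1))) (hz : ‖z‖ < r) :
    HasDerivAt (fun x => ∑' n, a n * x ^ n) (∑' n : ℕ, a n * (n * z ^ (n - 1))) z := by
  have hr : 0 < r := (norm_nonneg z).trans_lt hz
  refine hasDerivAt_tsum_of_isPreconnected (t := Metric.ball 0 r) (y₀ := 0) ha Metric.isOpen_ball
    (convex_ball 0 r).isPreconnected (fun n x _ => (hasDerivAt_pow n x).const_mul (a n))
    (fun n x hx => ?_) (Metric.mem_ball_self hr) ?_ (mem_ball_zero_iff.2 hz)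
  · rw [norm_mul, norm_mul, norm_pow, RCLike.norm_natCast]
    gcongr
    exact (mem_ball_zero_iff.1 hx).le
  · exact summable_of_ne_finset_zero (s := {0}) fun n hn => by
      simp [notMem_singleton.1 hn]

theorem summable_pow_mul_card_divisors_mul_pow (a : ℕ) {z : ℝ} (hz : |z| < 1) :
    Summable fun n : ℕ => (n : ℝ) ^ a * (#n.divisors * z ^ n) := by
  refine Summable.of_norm_bounded
    (summable_pow_mul_geometric_of_norm_lt_one (a + 1) (r := |z|) (by simpa using hz)) fun n => ?_
  rw [norm_mul, norm_mul, norm_pow, norm_pow, Real.norm_natCast, Real.norm_natCast,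
    Real.norm_eq_abs, pow_succ, mul_assoc]
  gcongr
  exact Nat.card_divisors_le_self n

theorem mul_mul_natCast_mul_pow_sub_one {R : Type*} [CommSemiring R] (c z : R) (n : ℕ) :
    z * (c * (n * z ^ (n - 1))) = n * (c * z ^ n) := by
  cases n with
  | zero => simp
  | succ n =>
    rw [Nat.add_sub_cancel, pow_succ]
    ring

section LambertSeries

variable {z : ℝ}

theorem hasSum_lambertSigma (hz : |z| < 1) :
    HasSum (fun n : ℕ => #n.divisors * z ^ n) (lambertSigma z) := by
  have hsum : Summable fun n : ℕ => #n.divisors * z ^ n := by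
    simpa using summable_pow_mul_card_divisors_mul_pow 0 hz
  have hlambert := tsum_pow_div_one_sub_eq_tsum_sigma (𝕜 := ℝ) (r := z) hz 0
  simp only [pow_zero, one_mul, ArithmeticFunction.sigma_zero_apply] at hlambert
  rw [tsum_pnat_eq_tsum_succ (f := fun n : ℕ => z ^ n / (1 - z ^ n)),
    tsum_pnat_eq_tsum_succ (f := fun n : ℕ => (#n.divisors : ℝ) * z ^ n)] at hlambert
  convert hsum.hasSum using 1
  simp [lambertSigma, hlambert, hsum.tsum_eq_zero_add]

theorem hasDerivAt_lambertSigma (hz : |z| < 1) :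
    HasDerivAt lambertSigma (∑' n : ℕ, #n.divisors * (n * z ^ (n - 1))) z := by
  obtain ⟨r, hzr, hr⟩ := exists_between hz
  have hr0 : 0 < r := (abs_nonneg z).trans_lt hzr
  have hsum : Summable fun n : ℕ => ‖(#n.divisors : ℝ)‖ * (n * r ^ (n - 1)) := by
    rw [← summable_mul_left_iff hr0.ne']
    simpa only [Real.norm_natCast, mul_mul_natCast_mul_pow_sub_one, pow_one] using
      summable_pow_mul_card_divisors_mul_pow 1 (abs_lt.2 ⟨by linarith, hr⟩)
  refine (hasDerivAt_tsum_mul_pow hsum hzr).congr_of_eventuallyEq ?_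
  filter_upwards [continuous_abs.continuousAt.eventually_lt_const hz] with x hx
  exact (hasSum_lambertSigma hx).tsum_eq.symm

theorem mul_deriv_lambertSigma (hz : |z| < 1) :
    z * deriv lambertSigma z = ∑' n : ℕ, n * (#n.divisors * z ^ n) := by
  simp only [(hasDerivAt_lambertSigma hz).deriv, ← tsum_mul_left, mul_mul_natCast_mul_pow_sub_one]

theorem mul_deriv_lambertSigma_pos (h0 : 0 < z) (h1 : z < 1) : 0 < z * deriv lambertSigma z := by
  have hz : |z| < 1 := abs_lt.2 ⟨by linarith, h1⟩
  rw [mul_deriv_lambertSigma hz]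
  have hsum := summable_pow_mul_card_divisors_mul_pow 1 hz
  simp only [pow_one] at hsum
  exact hsum.tsum_pos (fun n => by positivity) 1 (by simpa using h0)

theorem strictMonoOn_lambertSigma : StrictMonoOn lambertSigma (Set.Ico 0 1) := by
  intro x ⟨hx0, hx1⟩ y ⟨_, hy1⟩ hxy
  exact hasSum_lt (i := 1) (fun n => by gcongr) (by simpa using hxy)
    (hasSum_lambertSigma (abs_lt.2 ⟨by linarith, hx1⟩))
    (hasSum_lambertSigma (abs_lt.2 ⟨by linarith, hy1⟩))

theorem summable_pow_succ_div_one_sub_pow_succ (hz : |z| < 1) :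
    Summable fun n : ℕ => z ^ (n + 1) / (1 - z ^ (n + 1)) := by
  have hsum := summable_norm_pow_mul_geometric_div_one_sub (r := z) 0 hz
  simp only [pow_zero, one_mul] at hsum
  exact (summable_nat_add_iff 1).2 hsum

theorem sum_range_le_lambertSigma (h0 : 0 ≤ z) (h1 : z < 1) (N : ℕ) :
    ∑ n ∈ range N, z ^ (n + 1) / (1 - z ^ (n + 1)) ≤ lambertSigma z :=
  (summable_pow_succ_div_one_sub_pow_succ (abs_lt.2 ⟨by linarith, h1⟩)).sum_le_tsum _ fun n _ =>
    div_nonneg (by positivity) (sub_nonneg.2 (pow_le_one₀ h0 h1.le))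

theorem lambertSigma_le_sum_range_add (h0 : 0 ≤ z) (h1 : z < 1) (N : ℕ) :
    lambertSigma z ≤
      ∑ n ∈ range N, z ^ (n + 1) / (1 - z ^ (n + 1)) + z ^ (N + 1) / (1 - z) ^ 2 := by
  have hs := summable_pow_succ_div_one_sub_pow_succ (abs_lt.2 ⟨by linarith, h1⟩)
  have hgeom : HasSum (fun n : ℕ => z ^ (N + 1) / (1 - z) * z ^ n) (z ^ (N + 1) / (1 - z) ^ 2) := by
    rw [pow_two, ← div_div, div_eq_mul_inv _ (1 - z)]
    exact (hasSum_geometric_of_lt_one h0 h1).mul_left _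
  rw [lambertSigma, ← hs.sum_add_tsum_nat_add N]
  gcongr
  refine hasSum_le (fun n => ?_) ((summable_nat_add_iff N).2 hs).hasSum hgeom
  have hpow : z ^ (n + N + 1) ≤ z := pow_le_of_le_one h0 h1.le (Nat.succ_ne_zero _)
  calc z ^ (n + N + 1) / (1 - z ^ (n + N + 1)) ≤ z ^ (n + N + 1) / (1 - z) :=
        div_le_div_of_nonneg_left (by positivity) (by linarith) (by linarith)
    _ = z ^ (N + 1) / (1 - z) * z ^ n := by ring

theorem lambertSigma_lower_lt_one : lambertSigma 0.4055 < 1 := by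
  refine (lambertSigma_le_sum_range_add (by norm_num) (by norm_num) 9).trans_lt ?_
  norm_num [sum_range_succ]

theorem one_lt_lambertSigma_upper : 1 < lambertSigma 0.4065 := by
  refine lt_of_lt_of_le ?_ (sum_range_le_lambertSigma (by norm_num) (by norm_num) 9)
  norm_num [sum_range_succ]

theorem mem_Ico_of_lambertSigma_eq_one (hz : z ∈ Set.Icc (0 : ℝ) 1) (h : lambertSigma z = 1) :
    z ∈ Set.Ico (0 : ℝ) 1 := by
  refine ⟨hz.1, hz.2.lt_of_ne ?_⟩
  rintro rfl
  simp [lambertSigma] at h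

theorem existsUnique_lambertSigma_eq_one :
    ∃! ρ : ℝ, ρ ∈ Set.Icc (0 : ℝ) 1 ∧ lambertSigma ρ = 1 := by
  have hcont : ContinuousOn lambertSigma (Set.Icc 0.4055 0.4065) := fun x hx =>
    (hasDerivAt_lambertSigma (abs_lt.2
      ⟨by linarith [hx.1], by linarith [hx.2]⟩)).continuousAt.continuousWithinAt
  obtain ⟨ρ, hρ, hρ1⟩ := intermediate_value_Icc (by norm_num) hcont
    ⟨lambertSigma_lower_lt_one.le, one_lt_lambertSigma_upper.le⟩
  have hρI : ρ ∈ Set.Icc (0 : ℝ) 1 := ⟨by linarith [hρ.1], by linarith [hρ.2]⟩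
  exact ⟨ρ, ⟨hρI, hρ1⟩, fun x ⟨hxI, hx1⟩ => strictMonoOn_lambertSigma.injOn
    (mem_Ico_of_lambertSigma_eq_one hxI hx1) (mem_Ico_of_lambertSigma_eq_one hρI hρ1)
    (hx1.trans hρ1.symm)⟩

theorem mem_Ioo_of_lambertSigma_eq_one (hz : z ∈ Set.Icc (0 : ℝ) 1) (h : lambertSigma z = 1) :
    z ∈ Set.Ioo (0.4055 : ℝ) 0.4065 := by
  have hz' := mem_Ico_of_lambertSigma_eq_one hz h
  constructor
  · exact (strictMonoOn_lambertSigma.lt_iff_lt (by norm_num) hz').1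
      (h ▸ lambertSigma_lower_lt_one)
  · exact (strictMonoOn_lambertSigma.lt_iff_lt hz' (by norm_num)).1
      (h ▸ one_lt_lambertSigma_upper)

end LambertSeries

/-! ### Asymptotics -/

theorem two_mul_le_of_mem_properDivisors {m n : ℕ} (hm : m ∈ n.properDivisors) : 2 * m ≤ n := by
  obtain ⟨⟨k, rfl⟩, hlt⟩ := Nat.mem_properDivisors.1 hm
  have hk : 1 < k := lt_of_mul_lt_mul_left' (by rwa [mul_one])
  rw [mul_comm]
  gcongr
  exact hk

theorem norm_sum_properDivisors_mul_pow_le {a : ℕ → ℝ} {x C : ℝ} (hx0 : 0 ≤ x) (hx1 : x ≤ 1)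
    (ha : ∀ n, ‖a n * x ^ n‖ ≤ C) (n : ℕ) :
    ‖(∑ m ∈ n.properDivisors, a m) * x ^ n‖ ≤ C * (n * √x ^ n) := by
  have hC : 0 ≤ C := (norm_nonneg _).trans (ha 0)
  have hterm : ∀ m ∈ n.properDivisors, ‖a m * x ^ n‖ ≤ C * √x ^ n := by
    intro m hm
    have h2m := two_mul_le_of_mem_properDivisors hm
    calc ‖a m * x ^ n‖ = ‖a m * x ^ m‖ * x ^ (n - m) := by
          rw [← Real.norm_of_nonneg (pow_nonneg hx0 (n - m)), ← norm_mul, mul_assoc, ← pow_add,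
            Nat.add_sub_cancel' (by lia)]
      _ ≤ C * x ^ (n - m) := by gcongr; exact ha m
      _ = C * √x ^ (2 * (n - m)) := by rw [pow_mul, Real.sq_sqrt hx0]
      _ ≤ C * √x ^ n := by
          gcongr C * ?_
          exact pow_le_pow_of_le_one (Real.sqrt_nonneg _) (Real.sqrt_le_one.2 hx1) (by lia)
  calc ‖(∑ m ∈ n.properDivisors, a m) * x ^ n‖
      ≤ #n.properDivisors * (C * √x ^ n) := by
        rw [sum_mul, ← nsmul_eq_mul]
        exact (norm_sum_le _ _).trans (sum_le_card_nsmul _ _ _ hterm)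
    _ ≤ n * (C * √x ^ n) := by
        gcongr
        exact (card_le_card Nat.properDivisors_subset_divisors).trans (Nat.card_divisors_le_self n)
    _ = C * (n * √x ^ n) := by ring

theorem tendsto_sum_properDivisors_mul_pow {a : ℕ → ℝ} {x C : ℝ} (hx0 : 0 ≤ x) (hx1 : x < 1)
    (ha : ∀ n, ‖a n * x ^ n‖ ≤ C) :
    Tendsto (fun n => (∑ m ∈ n.properDivisors, a m) * x ^ n) atTop (𝓝 0) := by
  refine squeeze_zero_norm (norm_sum_properDivisors_mul_pow_le hx0 hx1.le ha) ?_
  simpa only [mul_zero] using (tendsto_self_mul_const_pow_of_lt_one (Real.sqrt_nonneg x)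
    ((Real.sqrt_lt_sqrt hx0 hx1).trans_eq Real.sqrt_one)).const_mul C

theorem tendsto_div_const_mul_zpow_neg {𝕜 : Type*} [NormedField 𝕜] {a : ℕ → 𝕜} {x M : 𝕜}
    (hM : M ≠ 0) (ha : Tendsto (fun n => a n * x ^ n) atTop (𝓝 (1 / M))) :
    Tendsto (fun n : ℕ => a n / (1 / M * x ^ (-(n : ℤ)))) atTop (𝓝 1) := by
  have hlim := ha.mul_const M
  rw [one_div_mul_cancel hM] at hlim
  refine hlim.congr fun n => ?_
  rw [zpow_neg, zpow_natCast, div_eq_mul_inv, mul_inv, inv_inv, one_div, inv_inv]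
  ring

section Asymptotics

variable {ρ : ℝ}

theorem isStepDistribution_card_divisors_mul_pow (h0 : 0 ≤ ρ) (h1 : ρ < 1)
    (h : lambertSigma ρ = 1) : IsStepDistribution fun n => #n.divisors * ρ ^ n where
  nonneg _ := by positivity
  apply_zero := by simp
  hasSum_one := h ▸ hasSum_lambertSigma (abs_lt.2 ⟨by linarith, h1⟩)

theorem tendsto_cSeq_mul_pow (h0 : 0 < ρ) (h1 : ρ < 1) (h : lambertSigma ρ = 1) :
    Tendsto (fun n => cSeq n * ρ ^ n) atTop (𝓝 (1 / (ρ * deriv lambertSigma ρ))) := by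
  have hρ : |ρ| < 1 := abs_lt.2 ⟨by linarith, h1⟩
  have haper : Nat.setGcd (fun n : ℕ => #n.divisors * ρ ^ n).support = 1 :=
    Nat.dvd_one.1 (Nat.setGcd_dvd_of_mem (by simpa using h0.ne'))
  rw [mul_deriv_lambertSigma hρ]
  exact (isRenewalSequence_cSeq.mul_pow ρ).tendsto_one_div_mean
    (isStepDistribution_card_divisors_mul_pow h0.le h1 h) haper
    (by simpa using summable_pow_mul_card_divisors_mul_pow 1 hρ)

theorem norm_dSeq_mul_pow_le_one (h0 : 0 ≤ ρ) (h1 : ρ < 1) (h : lambertSigma ρ = 1) (n : ℕ) :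
    ‖dSeq n * ρ ^ n‖ ≤ 1 := by
  rw [Real.norm_of_nonneg (by positivity)]
  calc (dSeq n : ℝ) * ρ ^ n ≤ cSeq n * ρ ^ n := by
        gcongr
        exact dSeq_le_cSeq n
    _ ≤ 1 := (isRenewalSequence_cSeq.mul_pow ρ).le_one
        (isStepDistribution_card_divisors_mul_pow h0 h1 h) n

theorem tendsto_dSeq_mul_pow (h0 : 0 < ρ) (h1 : ρ < 1) (h : lambertSigma ρ = 1) :
    Tendsto (fun n => dSeq n * ρ ^ n) atTop (𝓝 (1 / (ρ * deriv lambertSigma ρ))) := by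
  have hdiff := (tendsto_cSeq_mul_pow h0 h1 h).sub
    (tendsto_sum_properDivisors_mul_pow h0.le h1 (norm_dSeq_mul_pow_le_one h0.le h1 h))
  rw [sub_zero] at hdiff
  refine hdiff.congr' ?_
  filter_upwards [eventually_ne_atTop 0] with n hn
  rw [cSeq_eq_sum_divisors_dSeq hn, ← Nat.insert_self_properDivisors hn,
    sum_insert Nat.self_notMem_properDivisors]
  push_cast
  ring

end Asymptotics

theorem mainTheorem6 :
    (∃! ρ : ℝ, ρ ∈ Set.Icc (0 : ℝ) 1 ∧ lambertSigma ρ = 1) ∧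
    ∀ ρ : ℝ, ρ ∈ Set.Icc (0 : ℝ) 1 → lambertSigma ρ = 1 →
      |ρ - 0.406| < 0.0005 ∧
      DifferentiableAt ℝ lambertSigma ρ ∧
      Filter.Tendsto
        (fun n : ℕ => (dSeq n : ℝ) / (1 / (ρ * deriv lambertSigma ρ) * ρ ^ (-(n : ℤ))))
        Filter.atTop (nhds 1) ∧
      Filter.Tendsto
        (fun n : ℕ => (cSeq n : ℝ) / (1 / (ρ * deriv lambertSigma ρ) * ρ ^ (-(n : ℤ))))
        Filter.atTop (nhds 1) ∧
      Filter.Tendsto (fun n : ℕ => (dSeq n : ℝ) / (cSeq n : ℝ)) Filter.atTop (nhds 1) := by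
  refine ⟨existsUnique_lambertSigma_eq_one, fun ρ hρ h => ?_⟩
  obtain ⟨hlower, hupper⟩ := mem_Ioo_of_lambertSigma_eq_one hρ h
  have h0 : 0 < ρ := by linarith
  have h1 : ρ < 1 := by linarith
  have hM := (mul_deriv_lambertSigma_pos h0 h1).ne'
  have hc := tendsto_cSeq_mul_pow h0 h1 h
  have hd := tendsto_dSeq_mul_pow h0 h1 h
  refine ⟨abs_lt.2 ⟨by linarith, by linarith⟩,
    (hasDerivAt_lambertSigma (abs_lt.2 ⟨by linarith, h1⟩)).differentiableAt,
    tendsto_div_const_mul_zpow_neg hM hd, tendsto_div_const_mul_zpow_neg hM hc, ?_⟩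
  have hdc := hd.div hc (one_div_ne_zero hM)
  rw [div_self (one_div_ne_zero hM)] at hdc
  exact hdc.congr fun n => mul_div_mul_right _ _ (pow_pos h0 n).ne'
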